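/- **Theorem.** Let $n\geqslant 2$ and $X=(x_1,\ldots,x_n)$. For $i\geqslant 0$ let $\widetilde{Q}_i(X)=e_i(X)$ be the $i$-th elementary symmetric polynomial, for $i\geqslant j\geqslant 0$ let $$\widetilde{Q}_{i,j}(X)=\widetilde{Q}_i(X)\widetilde{Q}_j(X)+2\sum_{k=1}^{j}(-1)^k\,\widetilde{Q}_{i+k}(X)\,\widetilde{Q}_{j-k}(X),$$ and for a partition $\lambda=(\lambda_1\geqslant\cdots\geqslant\lambda_r\geqslant 0)$ with $r$ even (add a part $\lambda_r=0$ if necessary) let $\widetilde{Q}_\lambda(X)=\mathrm{Pfaffian}[\widetilde{Q}_{\lambda_i,\lambda_j}(X)]_{1\leqslant i<j\leqslant r}$. Define operators on $\mathbb{Z}[X]$ by $\partial_0 f=(f-s_0f)/(2x_1)$ and $\partial_1' f=(f-s_1f)/(x_2-x_1)$, where $s_0$ replaces $x_1$ by $-x_1$ and $s_1$ interchanges $x_1$ and $x_2$, and set $$\mathfrak{C}''_\lambda(X)=\partial_0\,\partial_1'\,\partial_0\bigl(\widetilde{Q}_\lambda(X)\bigr).$$ Let $\mathcal{D}_n$ be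 the set of strict partitions (all nonzero parts distinct) with $\lambda_1\leqslant n$; the length of $\lambda$ is the number of its nonzero parts, and $\lambda\smallsetminus\mu$ is the partition whose parts are the parts of $\lambda$ that are not parts of $\mu$. Then for every $\lambda=(\lambda_1>\cdots>\lambda_\ell>0)\in\mathcal{D}_n$ of even length $\ell\geqslant 4$, $$\sum_{j=1}^{\ell-1}(-1)^{j-1}\,\mathfrak{C}''_{\lambda_j,\lambda_\ell}(X)\;\mathfrak{C}''_{\lambda\smallsetminus\{\lambda_j,\lambda_\ell\}}(X)=0 .$$ -/

import Mathlib

namespace LagrangianPfaffian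

open MvPolynomial

/-! ### Divided difference operators on `ℤ[x_k : k ∈ σ]` -/

section DividedDifferences

variable {σ : Type*}

/-- If a ring endomorphism `s` fixes every variable modulo `d`, it fixes every polynomial
modulo `d`. -/
theorem dvd_sub_of_dvd_X (d : MvPolynomial σ ℤ)
    (s : MvPolynomial σ ℤ →ₐ[ℤ] MvPolynomial σ ℤ) (h : ∀ k, d ∣ X k - s (X k))
    (f : MvPolynomial σ ℤ) : d ∣ f - s f := by
  have key : Ideal.Quotient.mkₐ ℤ (Ideal.span {d})
      = (Ideal.Quotient.mkₐ ℤ (Ideal.span {d})).comp s := by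
    apply MvPolynomial.algHom_ext
    intro k
    exact Ideal.Quotient.eq.mpr (Ideal.mem_span_singleton.mpr (h k))
  exact Ideal.mem_span_singleton.mp (Ideal.Quotient.eq.mp (DFunLike.congr_fun key f))

variable [DecidableEq σ]

/-- The sign change `x_i ↦ -x_i`, all other variables being fixed. -/
noncomputable def signChange (i : σ) : MvPolynomial σ ℤ →ₐ[ℤ] MvPolynomial σ ℤ :=
  aeval fun k => if k = i then -X i else X k

/-- The interchange of `x_i` and `x_j`, all other variables being fixed. -/
noncomputable def swapVars (i j : σ) : MvPolynomial σ ℤ →ₐ[ℤ] MvPolynomial σ ℤ :=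
  rename (Equiv.swap i j)

theorem signChange_dvd (i : σ) (f : MvPolynomial σ ℤ) : 2 * X i ∣ f - signChange i f := by
  apply dvd_sub_of_dvd_X
  intro k
  by_cases hk : k = i
  · subst hk
    exact ⟨1, by simp [signChange]; ring⟩
  · simp [signChange, hk]

theorem swapVars_dvd (i j : σ) (f : MvPolynomial σ ℤ) :
    X j - X i ∣ f - swapVars i j f := by
  apply dvd_sub_of_dvd_X
  intro k
  by_cases hi : k = i
  · subst hi
    exact ⟨-1, by simp [swapVars]⟩
  · by_cases hj : k = j
    · subst hj
      exact ⟨1, by simp [swapVars]⟩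
    · simp [swapVars, Equiv.swap_apply_of_ne_of_ne hi hj]

/-- `(f - s f) / (2 x_i)`, where `s` changes the sign of `x_i`. The quotient is exact
(`signChange_dvd`), and unique because the polynomial ring is a domain. -/
noncomputable def divDiffSign (i : σ) (f : MvPolynomial σ ℤ) : MvPolynomial σ ℤ :=
  Classical.choose (signChange_dvd i f)

/-- `(f - s f) / (x_j - x_i)`, where `s` interchanges `x_i` and `x_j`. The quotient is exact
(`swapVars_dvd`), and unique if `i ≠ j` because the polynomial ring is a domain. -/
noncomputable def divDiffSwap (i j : σ) (f : MvPolynomial σ ℤ) : MvPolynomial σ ℤ :=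
  Classical.choose (swapVars_dvd i j f)

theorem divDiffSign_spec (i : σ) (f : MvPolynomial σ ℤ) :
    f - signChange i f = 2 * X i * divDiffSign i f :=
  Classical.choose_spec (signChange_dvd i f)

theorem divDiffSwap_spec (i j : σ) (f : MvPolynomial σ ℤ) :
    f - swapVars i j f = (X j - X i) * divDiffSwap i j f :=
  Classical.choose_spec (swapVars_dvd i j f)

end DividedDifferences

/-! ### Pfaffians -/

/-- The Pfaffian of the skew-symmetric `2m × 2m` array whose entries above the diagonal are
`A i j`, `i < j`, by expansion along the first row. Only the entries with `i < j` are used. -/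
def pfaffian {R : Type*} [CommRing R] :
    (m : ℕ) → (Fin (2 * m) → Fin (2 * m) → R) → R
  | 0, _ => 1
  | m + 1, A => ∑ j : Fin (2 * m + 1), (-1) ^ (j : ℕ) * A 0 j.succ *
      pfaffian m fun a b => A (j.succAbove a).succ (j.succAbove b).succ

/-! ### Strict partitions -/

/-- `lam` is (the list of nonzero parts of) a strict partition with largest part at most `n`. -/
def IsStrictPartition (n : ℕ) (lam : List ℕ) : Prop :=
  lam.Pairwise (· > ·) ∧ ∀ a ∈ lam, 1 ≤ a ∧ a ≤ n

/-- The `k`-th part of `lam`, counted from `k = 1`; it is `0` beyond the length. -/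
def part (lam : List ℕ) (k : ℕ) : ℕ := lam.getD (k - 1) 0

/-- The partition whose parts are the parts of `lam` that are not parts of `mu`. -/
def remove (lam mu : List ℕ) : List ℕ := lam.filter fun a => a ∉ mu

/-! ### `Q̃`-polynomials in `x_1, …, x_n`; the variable `x_k` is `X ⟨k - 1, _⟩` -/

/-- `Q̃_i(X) = e_i(x_1, …, x_n)`. -/
noncomputable def Qtilde1 (n i : ℕ) : MvPolynomial (Fin n) ℤ := esymm (Fin n) ℤ i

/-- `Q̃_{i,j}(X)` for `i ≥ j ≥ 0`. -/
noncomputable def Qtilde2 (n i j : ℕ) : MvPolynomial (Fin n) ℤ :=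
  Qtilde1 n i * Qtilde1 n j +
    2 * ∑ k ∈ Finset.Icc 1 j, (-1) ^ k * (Qtilde1 n (i + k) * Qtilde1 n (j - k))

/-- `Q̃_λ(X)`, the Pfaffian of `Q̃_{λ_i,λ_j}(X)`, `1 ≤ i < j ≤ r`, where `r` is the least even
number that is at least the length of `λ` (so `λ_r = 0` if the length is odd). -/
noncomputable def Qtilde (n : ℕ) (lam : List ℕ) : MvPolynomial (Fin n) ℤ :=
  pfaffian ((lam.length + 1) / 2) fun i j =>
    Qtilde2 n (part lam ((i : ℕ) + 1)) (part lam ((j : ℕ) + 1))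

/-- `∂₀`, with `∂₀ f = (f - s₀ f) / (2 x_1)`. -/
noncomputable def del0 {n : ℕ} (hn : 2 ≤ n) (f : MvPolynomial (Fin n) ℤ) :
    MvPolynomial (Fin n) ℤ :=
  divDiffSign ⟨0, by omega⟩ f

/-- `∂₁'`, with `∂₁' f = (f - s₁ f) / (x_2 - x_1)`. -/
noncomputable def del1' {n : ℕ} (hn : 2 ≤ n) (f : MvPolynomial (Fin n) ℤ) :
    MvPolynomial (Fin n) ℤ :=
  divDiffSwap ⟨0, by omega⟩ ⟨1, by omega⟩ f

/-- `ℭ''_λ(X) = ∂₀ ∂₁' ∂₀ (Q̃_λ(X))`. -/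
noncomputable def C'' {n : ℕ} (hn : 2 ≤ n) (lam : List ℕ) : MvPolynomial (Fin n) ℤ :=
  del0 hn (del1' hn (del0 hn (Qtilde n lam)))

end LagrangianPfaffian

open LagrangianPfaffian

namespace LagrangianPfaffian

open MvPolynomial

/-! ### Pfaffians of tuples of indices -/

section TuplePfaffian

variable {ι R : Type*} [CommRing R]

-- Let `f_k` be the elementary symmetric polynomials in `x_3, …, x_n`. Splitting off `x_1` and `x_2`
-- (`Qtilde2_eq`) writes `Q̃_{i,j}` as an entry depending on them only through `x_1² + x_2²` and
-- `x_1² x_2²`, plus a combination of the 2×2 minors of the three rows `(f_i)`, `(f_{i-1})`,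
-- `(f_{i-2})`, with coefficients `x_1 + x_2`, `x_1 x_2 (x_1 + x_2)` and `x_1 x_2`. The wedge of two
-- 2-forms on a three-dimensional space is zero, so the Pfaffian `Q̃_λ` is affine-linear in these
-- three coefficients (`tuplePfaffian_add_twoForm`). The operator `∂₀ ∂₁' ∂₀` is linear over
-- invariants and picks out the coefficient of `x_1 x_2 (x_1 + x_2)`. Hence `ℭ''_λ` is minus the
-- Pfaffian of the invariant array bordered by the rows with shifts 2 and 1 (`C''_ofFn`), and for
-- two parts it is a 2×2 minor of these rows (`C''_pair`). Expanding that minor along the part `λ_ℓ`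
-- splits the alternating sum into two. Each is the first-row expansion of a Pfaffian with three
-- added rows (`sum_mul_tuplePfaffian_removeNth`), of shifts 1, 2, 1 and 2, 2, 1. A row is repeated,
-- so both vanish.

/-- The Pfaffian of the array `A (v i) (v j)`, by expansion along the first row; it is `0` if the
tuple `v` has odd length. -/
def tuplePfaffian (A : ι → ι → R) : (n : ℕ) → (Fin n → ι) → R
  | 0, _ => 1
  | 1, _ => 0
  | n + 2, v => ∑ j : Fin (n + 1), (-1) ^ (j : ℕ) * A (v 0) (v j.succ) *
      tuplePfaffian A n fun a => v (j.succAbove a).succ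

theorem tuplePfaffian_zero (A : ι → ι → R) (v : Fin 0 → ι) : tuplePfaffian A 0 v = 1 := by
  rw [tuplePfaffian]

theorem tuplePfaffian_one (A : ι → ι → R) (v : Fin 1 → ι) : tuplePfaffian A 1 v = 0 := by
  rw [tuplePfaffian]

theorem tuplePfaffian_cons (A : ι → ι → R) (n : ℕ) (a : ι) (w : Fin (n + 1) → ι) :
    tuplePfaffian A (n + 2) (Fin.cons a w) =
      ∑ j : Fin (n + 1), (-1) ^ (j : ℕ) * A a (w j) * tuplePfaffian A n (j.removeNth w) := by
  rw [tuplePfaffian]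
  rfl

theorem removeNth_succ_cons {n : ℕ} (b : ι) (w : Fin (n + 1) → ι) (j : Fin (n + 1)) :
    Fin.removeNth (α := fun _ => ι) j.succ (Fin.cons b w : Fin (n + 2) → ι) =
      (Fin.cons b (j.removeNth w) : Fin (n + 1) → ι) := by
  funext i
  refine Fin.cases ?_ (fun i => ?_) i <;> simp [Fin.removeNth]

theorem tuplePfaffian_pair (A : ι → ι → R) (a b : ι) (w : Fin 0 → ι) :
    tuplePfaffian A 2 (Fin.cons a (Fin.cons b w : Fin 1 → ι)) = A a b := by
  rw [tuplePfaffian_cons]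
  simp [tuplePfaffian_zero]

theorem tuplePfaffian_three (A : ι → ι → R) (v : Fin 3 → ι) : tuplePfaffian A 3 v = 0 := by
  rw [tuplePfaffian]
  simp [tuplePfaffian_one]

theorem tuplePfaffian_cons_cons (A : ι → ι → R) (n : ℕ) (a b : ι) (w : Fin (n + 1) → ι) :
    tuplePfaffian A (n + 3) (Fin.cons a (Fin.cons b w : Fin (n + 2) → ι)) =
      A a b * tuplePfaffian A (n + 1) w -
        ∑ j : Fin (n + 1), (-1) ^ (j : ℕ) * A a (w j) *
          tuplePfaffian A (n + 1) (Fin.cons b (j.removeNth w)) := by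
  rw [tuplePfaffian_cons, Fin.sum_univ_succ, sub_eq_add_neg, ← Finset.sum_neg_distrib]
  congr 1
  · simp
  · refine Finset.sum_congr rfl fun j _ => ?_
    rw [removeNth_succ_cons, Fin.cons_succ, Fin.val_succ, pow_succ]
    ring

theorem tuplePfaffian_cons_cons_cons (A : ι → ι → R) (n : ℕ) (a b c : ι) (w : Fin (n + 1) → ι) :
    tuplePfaffian A (n + 4) (Fin.cons a (Fin.cons b (Fin.cons c w : Fin (n + 2) → ι) :
        Fin (n + 3) → ι)) =
      A a b * tuplePfaffian A (n + 2) (Fin.cons c w) - A a c * tuplePfaffian A (n + 2)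
        (Fin.cons b w) + ∑ j : Fin (n + 1), (-1) ^ (j : ℕ) * A a (w j) *
          tuplePfaffian A (n + 2) (Fin.cons b (Fin.cons c (j.removeNth w) : Fin (n + 1) → ι)) := by
  rw [tuplePfaffian_cons_cons, Fin.sum_univ_succ, sub_add_eq_sub_sub, sub_eq_add_neg (_ - _),
    ← Finset.sum_neg_distrib]
  congr 1
  · simp
  · refine Finset.sum_congr rfl fun j _ => ?_
    rw [removeNth_succ_cons, Fin.cons_succ, Fin.val_succ, pow_succ]
    ring

/-- The involution of the set of ordered pairs of distinct positions that exchanges the two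
positions, a pair being encoded as a position and a position among the remaining ones. -/
def exchangePositions (n : ℕ) : Fin (n + 2) × Fin (n + 1) ≃ Fin (n + 2) × Fin (n + 1) :=
  Function.Involutive.toPerm (fun x => (x.1.succAbove x.2, x.2.predAbove x.1)) fun x => by
    ext1
    · exact Fin.succAbove_succAbove_predAbove _ _
    · exact Fin.predAbove_predAbove_succAbove _ _

/-- Removing two entries with a sign is antisymmetric in the weights of the two entries. -/
theorem sum_removeNth_removeNth_antisymm {n : ℕ} (φ ψ : ι → R) (F : (Fin n → ι) → R)
    (w : Fin (n + 2) → ι) :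
    ∑ j : Fin (n + 2), (-1) ^ (j : ℕ) * φ (w j) * ∑ k : Fin (n + 1),
      (-1) ^ (k : ℕ) * ψ (j.removeNth w k) * F (k.removeNth (j.removeNth w)) =
    -∑ j : Fin (n + 2), (-1) ^ (j : ℕ) * ψ (w j) * ∑ k : Fin (n + 1),
      (-1) ^ (k : ℕ) * φ (j.removeNth w k) * F (k.removeNth (j.removeNth w)) := by
  simp only [Finset.mul_sum, ← Finset.sum_neg_distrib]
  rw [← Fintype.sum_prod_type', ← Fintype.sum_prod_type',
    ← Equiv.sum_comp (exchangePositions n)]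
  refine Finset.sum_congr rfl fun x _ => ?_
  obtain ⟨j, k⟩ := x
  -- Removing the same two entries in the other order changes the parity of the sum of the two
  -- positions.
  have h := Fin.neg_one_pow_succAbove_add_predAbove (R := R) j k
  rw [pow_add, pow_add] at h
  have h2 := Fin.removeNth_removeNth_eq_swap w k j
  change (-1) ^ (j.succAbove k : ℕ) * φ (w (j.succAbove k)) * ((-1) ^ (k.predAbove j : ℕ) *
    ψ (w ((j.succAbove k).succAbove (k.predAbove j))) *
    F ((k.predAbove j).removeNth ((j.succAbove k).removeNth w))) =
    -((-1) ^ (j : ℕ) * ψ (w j) * ((-1) ^ (k : ℕ) * φ (w (j.succAbove k)) *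
      F (k.removeNth (j.removeNth w))))
  rw [← h2, Fin.succAbove_succAbove_predAbove]
  linear_combination (φ (w (j.succAbove k)) * ψ (w j) * F (k.removeNth (j.removeNth w))) * h

/-- No induction is needed: after expansion along both leading rows, `A a b` changes sign by
skewness and the remaining double sum by antisymmetry in the two removed entries. -/
theorem tuplePfaffian_swap (A : ι → ι → R) (hA : ∀ a b, A a b = -A b a) (n : ℕ) (a b : ι)
    (w : Fin n → ι) :
    tuplePfaffian A (n + 2) (Fin.cons a (Fin.cons b w : Fin (n + 1) → ι)) =
      -tuplePfaffian A (n + 2) (Fin.cons b (Fin.cons a w : Fin (n + 1) → ι)) := by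
  match n, w with
  | 0, w => rw [tuplePfaffian_pair, tuplePfaffian_pair, hA]
  | 1, w => rw [tuplePfaffian_three, tuplePfaffian_three, neg_zero]
  | n + 2, w =>
    rw [tuplePfaffian_cons_cons, tuplePfaffian_cons_cons, hA a b]
    simp only [tuplePfaffian_cons]
    rw [sum_removeNth_removeNth_antisymm]
    ring

theorem tuplePfaffian_swap_tail (A : ι → ι → R) (hA : ∀ a b, A a b = -A b a) (n : ℕ)
    (a b c : ι) (w : Fin n → ι) :
    tuplePfaffian A (n + 3) (Fin.cons a (Fin.cons b (Fin.cons c w : Fin (n + 1) → ι) :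
      Fin (n + 2) → ι)) =
      -tuplePfaffian A (n + 3) (Fin.cons a (Fin.cons c (Fin.cons b w : Fin (n + 1) → ι) :
        Fin (n + 2) → ι)) := by
  match n, w with
  | 0, w => rw [tuplePfaffian_three, tuplePfaffian_three, neg_zero]
  | n + 1, w =>
    rw [tuplePfaffian_cons_cons_cons, tuplePfaffian_cons_cons_cons]
    simp only [tuplePfaffian_swap A hA n b c, mul_neg, Finset.sum_neg_distrib]
    ring

theorem tuplePfaffian_self [NoZeroDivisors R] [CharZero R] (A : ι → ι → R)
    (hA : ∀ a b, A a b = -A b a) (n : ℕ) (a : ι) (w : Fin n → ι) :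
    tuplePfaffian A (n + 2) (Fin.cons a (Fin.cons a w : Fin (n + 1) → ι)) = 0 :=
  self_eq_neg.mp (tuplePfaffian_swap A hA n a a w)

theorem map_tuplePfaffian {S : Type*} [CommRing S] (φ : R →+* S) (A : ι → ι → R) :
    ∀ (n : ℕ) (v : Fin n → ι),
      φ (tuplePfaffian A n v) = tuplePfaffian (fun a b => φ (A a b)) n v
  | 0, v => by simp [tuplePfaffian_zero]
  | 1, v => by simp [tuplePfaffian_one]
  | n + 2, v => by
    rw [tuplePfaffian, tuplePfaffian, map_sum]
    refine Finset.sum_congr rfl fun j _ => ?_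
    rw [map_mul, map_mul, map_tuplePfaffian φ A n]
    simp

/-- Only the entries above the diagonal of the array matter. -/
theorem pfaffian_eq_tuplePfaffian (A : ι → ι → R) :
    ∀ (m : ℕ) (B : Fin (2 * m) → Fin (2 * m) → R) (v : Fin (2 * m) → ι),
      (∀ i j, i < j → B i j = A (v i) (v j)) → pfaffian m B = tuplePfaffian A (2 * m) v
  | 0, B, v, h => by rw [pfaffian]; exact (tuplePfaffian_zero A v).symm
  | m + 1, B, v, h => by
    rw [pfaffian]
    refine Eq.trans ?_ (tuplePfaffian.eq_3 A (2 * m) v).symm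
    refine Finset.sum_congr rfl fun j _ => ?_
    rw [h 0 j.succ (Fin.succ_pos j)]
    congr 1
    refine pfaffian_eq_tuplePfaffian A m _ _ fun a b hab => h _ _ ?_
    exact Fin.succ_lt_succ_iff.mpr (Fin.succAbove_lt_succAbove_iff.mpr hab)

-- Changing a skew-symmetric array by 2-forms on three added rows

section Perturbation

variable (A : ι → ι → R)

/-- The sum `∑ ± A x (w j) Pf(y, z, w without w j)` is a Pfaffian with three rows added, if the
added rows are mutually orthogonal. -/
theorem sum_mul_tuplePfaffian_removeNth {x y z : ι} (hxy : A x y = 0) (hxz : A x z = 0) {n : ℕ}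
    (w : Fin (n + 1) → ι) :
    ∑ j : Fin (n + 1), (-1) ^ (j : ℕ) * A x (w j) *
      tuplePfaffian A (n + 2) (Fin.cons y (Fin.cons z (j.removeNth w) : Fin (n + 1) → ι)) =
    tuplePfaffian A (n + 4) (Fin.cons x (Fin.cons y (Fin.cons z w : Fin (n + 2) → ι) :
        Fin (n + 3) → ι)) := by
  rw [tuplePfaffian_cons_cons_cons, hxy, hxz]
  ring

theorem tuplePfaffian_rotate (hA : ∀ a b, A a b = -A b a) (n : ℕ) (a b c : ι) (w : Fin n → ι) :
    tuplePfaffian A (n + 3) (Fin.cons a (Fin.cons b (Fin.cons c w : Fin (n + 1) → ι) :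
      Fin (n + 2) → ι)) =
      tuplePfaffian A (n + 3) (Fin.cons c (Fin.cons a (Fin.cons b w : Fin (n + 1) → ι) :
        Fin (n + 2) → ι)) := by
  rw [tuplePfaffian_swap_tail A hA, tuplePfaffian_swap A hA, neg_neg]

/-- Expansion of a Pfaffian with two rows `x`, `y` added along the third row. -/
theorem tuplePfaffian_expand_third (hA : ∀ a b, A a b = -A b a) (n : ℕ) (x y a : ι)
    (w : Fin (n + 1) → ι) :
    tuplePfaffian A (n + 4) (Fin.cons x (Fin.cons y (Fin.cons a w : Fin (n + 2) → ι) :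
      Fin (n + 3) → ι)) =
    ∑ j : Fin (n + 1), (-1) ^ (j : ℕ) * (A a (w j) *
      tuplePfaffian A (n + 2) (Fin.cons x (Fin.cons y (j.removeNth w) : Fin (n + 1) → ι)) -
      (A x a * A y (w j) - A y a * A x (w j)) * tuplePfaffian A n (j.removeNth w)) := by
  rw [tuplePfaffian_rotate A hA, tuplePfaffian_cons_cons_cons, tuplePfaffian_cons,
    tuplePfaffian_cons, hA a x, hA a y, Finset.mul_sum, Finset.mul_sum, ← Finset.sum_sub_distrib,
    ← Finset.sum_add_distrib]
  refine Finset.sum_congr rfl fun j _ => ?_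
  ring

/-- The Pfaffian of a skew-symmetric array changed by a combination of the three 2-forms on three
mutually orthogonal rows `p`, `q`, `r`. Every 2-form in three dimensions is decomposable, so no
terms of higher order occur. -/
theorem tuplePfaffian_add_twoForm [NoZeroDivisors R] [CharZero R] {p q r : ι}
    (hA : ∀ a b, A a b = -A b a) (hpq : A p q = 0) (hqr : A q r = 0) (hpr : A p r = 0) (α β γ : R) :
    ∀ (n : ℕ) (v : Fin n → ι),
      tuplePfaffian (fun i j => A i j + α * (A q i * A p j - A p i * A q j) +
        β * (A r i * A q j - A q i * A r j) + γ * (A r i * A p j - A p i * A r j)) n v =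
      tuplePfaffian A n v -
        (α * tuplePfaffian A (n + 2) (Fin.cons q (Fin.cons p v : Fin (n + 1) → ι)) +
          β * tuplePfaffian A (n + 2) (Fin.cons r (Fin.cons q v : Fin (n + 1) → ι)) +
          γ * tuplePfaffian A (n + 2) (Fin.cons r (Fin.cons p v : Fin (n + 1) → ι)))
  | 0, v => by
    rw [tuplePfaffian_zero, tuplePfaffian_zero, tuplePfaffian_pair, tuplePfaffian_pair,
      tuplePfaffian_pair, hA q p, hA r q, hA r p, hpq, hqr, hpr]
    ring
  | 1, v => by
    rw [tuplePfaffian_one, tuplePfaffian_one, tuplePfaffian_three, tuplePfaffian_three,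
      tuplePfaffian_three]
    ring
  | n + 2, v => by
    have hqp : A q p = 0 := by rw [hA, hpq, neg_zero]
    have hrq : A r q = 0 := by rw [hA, hqr, neg_zero]
    have hrp : A r p = 0 := by rw [hA, hpr, neg_zero]
    have hs : ∀ x, A x x = 0 := fun x => self_eq_neg.mp (hA x x)
    obtain ⟨a, w, rfl⟩ : ∃ a w, v = Fin.cons a w := ⟨_, _, (Fin.cons_self_tail v).symm⟩
    have E := fun x y => tuplePfaffian_expand_third A hA n x y a w
    have hxx : ∀ x y, tuplePfaffian A (n + 4) (Fin.cons x (Fin.cons x (Fin.cons y w :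
        Fin (n + 2) → ι) : Fin (n + 3) → ι)) = 0 := fun x y => tuplePfaffian_self A hA _ _ _
    have hxyx : ∀ x y, tuplePfaffian A (n + 4) (Fin.cons x (Fin.cons y (Fin.cons x w :
        Fin (n + 2) → ι) : Fin (n + 3) → ι)) = 0 := fun x y => by
      rw [tuplePfaffian_swap_tail A hA, hxx, neg_zero]
    set S : ι → ι → ι → R := fun x y z => ∑ j : Fin (n + 1), (-1) ^ (j : ℕ) * A x (w j) *
      tuplePfaffian A (n + 2) (Fin.cons y (Fin.cons z (j.removeNth w) : Fin (n + 1) → ι)) with hS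
    have K : ∀ x y z, A x y = 0 → A x z = 0 → S x y z = tuplePfaffian A (n + 4) (Fin.cons x
        (Fin.cons y (Fin.cons z w : Fin (n + 2) → ι) : Fin (n + 3) → ι)) :=
      fun x y z h1 h2 => sum_mul_tuplePfaffian_removeNth A h1 h2 w
    have prq : S p r q = S r q p := by
      rw [K p r q hpr hpq, K r q p hrq hrp, tuplePfaffian_rotate A hA, tuplePfaffian_rotate A hA]
    have qrp : S q r p = -S r q p := by
      rw [K q r p hqr hqp, K r q p hrq hrp, tuplePfaffian_swap A hA]
    -- These are the terms quadratic in `α`, `β`, `γ`: a correction of the first row times a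
    -- correction of the smaller Pfaffian. Those with a repeated row vanish, and the others cancel
    -- in pairs by `prq` and `qrp`.
    have cross : α * (A q a * (α * S p q p + β * S p r q + γ * S p r p) -
          A p a * (α * S q q p + β * S q r q + γ * S q r p)) +
        β * (A r a * (α * S q q p + β * S q r q + γ * S q r p) -
          A q a * (α * S r q p + β * S r r q + γ * S r r p)) +
        γ * (A r a * (α * S p q p + β * S p r q + γ * S p r p) -
          A p a * (α * S r q p + β * S r r q + γ * S r r p)) = 0 := by
      rw [prq, qrp, K p q p hpq (hs p), K q q p (hs q) hqp, K q r q hqr (hs q),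
        K r r q (hs r) hrq, K p r p hpr (hs p), K r r p (hs r) hrp, hxyx, hxyx, hxyx, hxx, hxx,
        hxx]
      ring
    rw [tuplePfaffian_cons, tuplePfaffian_cons, E, E, E, ← sub_zero (_ - _), ← cross]
    simp only [tuplePfaffian_add_twoForm hA hpq hqr hpr α β γ n, hS, Finset.mul_sum,
      ← Finset.sum_add_distrib, ← Finset.sum_sub_distrib]
    refine Finset.sum_congr rfl fun j _ => ?_
    ring

end Perturbation

end TuplePfaffian

/-! ### The quadratic polynomials `Q̃_{i,j}` of a sequence -/

section Quadratic

variable {R : Type*} [CommRing R]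

/-- `Q̃_{i,j}` formed from an arbitrary sequence `f` in place of the elementary symmetric
polynomials, with the sum cut off at `K`. -/
def quadQ (f : ℤ → R) (K : ℕ) (i j : ℤ) : R :=
  f i * f j + 2 * ∑ k ∈ Finset.Icc 1 K, (-1) ^ k * (f (i + k) * f (j - k))

/-- The sum telescopes; it collects the terms linear in `x` in `quadQ_add_mul_shift`. -/
theorem sum_neg_one_pow_mul_add_succ (c : ℕ → R) (K : ℕ) :
    ∑ k ∈ Finset.Icc 1 K, (-1) ^ k * (c k + c (k + 1)) = (-1) ^ K * c (K + 1) - c 1 := by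
  induction K with
  | zero => simp
  | succ K ih =>
    rw [Finset.sum_Icc_succ_top (by omega), ih]
    ring

/-- The effect on `quadQ` of multiplying the generating function of `f` by `1 + x t`. -/
theorem quadQ_add_mul_shift (f : ℤ → R) (hf : ∀ k < 0, f k = 0) (x : R) (K : ℕ) (i j : ℤ)
    (hj : j ≤ K) :
    quadQ (fun k => f k + x * f (k - 1)) K i j =
      quadQ f K i j + x ^ 2 * quadQ f K (i - 1) (j - 1) +
        x * (f (i - 1) * f j - f i * f (j - 1)) := by
  have h := sum_neg_one_pow_mul_add_succ (fun k => f (i - 1 + k) * f (j - k)) K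
  -- The cutoff satisfies `j ≤ K`, so the upper end of the telescoping sum contains a factor of
  -- negative index and only `-f i * f (j - 1)` survives.
  rw [hf (j - (K + 1 : ℕ)) (by push_cast; omega)] at h
  have hc : ∑ k ∈ Finset.Icc 1 K, (-1 : R) ^ k * ((f (i + k) + x * f (i + k - 1)) *
      (f (j - k) + x * f (j - k - 1))) =
      ∑ k ∈ Finset.Icc 1 K, (-1 : R) ^ k * (f (i + k) * f (j - k)) +
      x ^ 2 * ∑ k ∈ Finset.Icc 1 K, (-1 : R) ^ k * (f (i - 1 + k) * f (j - 1 - k)) +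
      x * ∑ k ∈ Finset.Icc 1 K, (-1 : R) ^ k * (f (i - 1 + k) * f (j - k) +
        f (i - 1 + (k + 1 : ℕ)) * f (j - (k + 1 : ℕ))) := by
    rw [Finset.mul_sum, Finset.mul_sum, ← Finset.sum_add_distrib, ← Finset.sum_add_distrib]
    refine Finset.sum_congr rfl fun k _ => ?_
    rw [show i - 1 + ((k + 1 : ℕ) : ℤ) = i + k by push_cast; ring,
      show j - ((k + 1 : ℕ) : ℤ) = j - k - 1 by push_cast; ring,
      show i + (k : ℤ) - 1 = i - 1 + k by ring, show j - 1 - (k : ℤ) = j - k - 1 by ring]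
    ring
  unfold quadQ
  rw [hc, h, show i - 1 + ((1 : ℕ) : ℤ) = i by push_cast; ring, Nat.cast_one]
  ring

theorem quadQ_add_mul_shift_twice (f : ℤ → R) (hf : ∀ k < 0, f k = 0) (x y : R) (K : ℕ)
    (i j : ℤ) (hj : j ≤ K) :
    quadQ (fun k => (f k + y * f (k - 1)) + x * (f (k - 1) + y * f (k - 1 - 1))) K i j =
      quadQ f K i j + (x ^ 2 + y ^ 2) * quadQ f K (i - 1) (j - 1) +
        x ^ 2 * y ^ 2 * quadQ f K (i - 2) (j - 2) +
        (x + y) * (f (i - 1) * f j - f i * f (j - 1)) +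
        x * y * (x + y) * (f (i - 2) * f (j - 1) - f (i - 1) * f (j - 2)) +
        x * y * (f (i - 2) * f j - f i * f (j - 2)) := by
  rw [quadQ_add_mul_shift (fun k => f k + y * f (k - 1))
      (fun k hk => by simp [hf k hk, hf (k - 1) (by omega)]) x K i j hj,
    quadQ_add_mul_shift f hf y K i j hj, quadQ_add_mul_shift f hf y K (i - 1) (j - 1) (by omega),
    show i - 1 - 1 = i - 2 by ring, show j - 1 - 1 = j - 2 by ring]
  ring

end Quadratic

/-! ### Elementary symmetric functions of multisets with integer index -/

section Esymm

variable {R : Type*} [CommRing R]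

/-- The elementary symmetric function of a multiset, extended by `0` to negative indices. -/
def esymmInt (s : Multiset R) (k : ℤ) : R := if 0 ≤ k then s.esymm k.toNat else 0

theorem esymmInt_neg (s : Multiset R) (k : ℤ) (hk : k < 0) : esymmInt s k = 0 :=
  if_neg (not_le.mpr hk)

theorem esymmInt_natCast (s : Multiset R) (k : ℕ) : esymmInt s k = s.esymm k := by
  simp [esymmInt]

theorem esymm_cons_succ (a : R) (s : Multiset R) (k : ℕ) :
    (a ::ₘ s).esymm (k + 1) = s.esymm (k + 1) + a * s.esymm k := by
  simp [Multiset.esymm, Multiset.powersetCard_cons, Multiset.sum_map_mul_left]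

theorem esymmInt_cons (a : R) (s : Multiset R) (k : ℤ) :
    esymmInt (a ::ₘ s) k = esymmInt s k + a * esymmInt s (k - 1) := by
  rcases lt_trichotomy k 0 with hk | rfl | hk
  · simp [esymmInt_neg _ k hk, esymmInt_neg s (k - 1) (by omega)]
  · simp [esymmInt, Multiset.esymm]
  · obtain ⟨m, rfl⟩ : ∃ m : ℕ, k = (m + 1 : ℕ) := ⟨k.toNat - 1, by omega⟩
    rw [show ((m + 1 : ℕ) : ℤ) - 1 = m by push_cast; ring, esymmInt_natCast, esymmInt_natCast,
      esymmInt_natCast, esymm_cons_succ]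

theorem map_esymmInt {S : Type*} [CommRing S] (φ : R →+* S) (s : Multiset R) (k : ℤ) :
    φ (esymmInt s k) = esymmInt (s.map φ) k := by
  unfold esymmInt
  split_ifs
  · simp only [Multiset.esymm, map_multiset_sum, Multiset.map_map, Multiset.powersetCard_map,
      Function.comp_def, map_multiset_prod]
  · simp

end Esymm

/-! ### The decomposition of `Q̃_λ` with respect to the first two variables -/

section Decomposition

variable (N : ℕ)

/-- The elementary symmetric polynomials in all variables but the first two. -/
noncomputable def restEsymm : ℤ → MvPolynomial (Fin (N + 2)) ℤ :=
  esymmInt (Finset.univ.val.map fun i : Fin N => X i.succ.succ)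

theorem map_restEsymm (φ : MvPolynomial (Fin (N + 2)) ℤ →+* MvPolynomial (Fin (N + 2)) ℤ)
    (hφ : ∀ i : Fin N, φ (X i.succ.succ) = X i.succ.succ) (k : ℤ) :
    φ (restEsymm N k) = restEsymm N k := by
  rw [restEsymm, map_esymmInt, Multiset.map_map]
  simp only [Function.comp_def, hφ]

theorem Qtilde1_eq_restEsymm (k : ℕ) :
    Qtilde1 (N + 2) k = (restEsymm N k + X 1 * restEsymm N (k - 1)) +
      X 0 * (restEsymm N (k - 1) + X 1 * restEsymm N (k - 1 - 1)) := by
  have h : (Finset.univ : Finset (Fin (N + 2))).val.map (X (R := ℤ)) =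
      X 0 ::ₘ X 1 ::ₘ Finset.univ.val.map fun i : Fin N => X i.succ.succ := by
    rw [Fin.univ_succ, Finset.cons_val, Multiset.map_cons, Finset.map_val, Fin.univ_succ,
      Finset.cons_val, Finset.map_val]
    simp [Function.comp_def]
  rw [Qtilde1, esymm_eq_multiset_esymm, ← esymmInt_natCast, h]
  simp only [esymmInt_cons, restEsymm]

/-- The part of `Q̃_{i,j}` that is invariant under sign changes and permutations of the first two
variables. -/
noncomputable def evenPart (i j : ℕ) : MvPolynomial (Fin (N + 2)) ℤ :=
  quadQ (restEsymm N) (N + 2) i j +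
    (X 0 ^ 2 + X 1 ^ 2) * quadQ (restEsymm N) (N + 2) (i - 1) (j - 1) +
    X 0 ^ 2 * X 1 ^ 2 * quadQ (restEsymm N) (N + 2) (i - 2) (j - 2)

theorem Qtilde2_eq (i j : ℕ) (hj : j ≤ N + 2) :
    Qtilde2 (N + 2) i j = evenPart N i j +
      (X 0 + X 1) * (restEsymm N (i - 1) * restEsymm N j - restEsymm N i * restEsymm N (j - 1)) +
      X 0 * X 1 * (X 0 + X 1) * (restEsymm N (i - 2) * restEsymm N (j - 1) -
        restEsymm N (i - 1) * restEsymm N (j - 2)) +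
      X 0 * X 1 * (restEsymm N (i - 2) * restEsymm N j -
        restEsymm N i * restEsymm N (j - 2)) := by
  rw [evenPart, ← quadQ_add_mul_shift_twice (restEsymm N) (fun k hk => esymmInt_neg _ k hk)
    (X 0) (X 1) (N + 2) i j (by exact_mod_cast hj), Qtilde2, quadQ, ← Qtilde1_eq_restEsymm,
    ← Qtilde1_eq_restEsymm]
  refine congrArg (fun s => Qtilde1 (N + 2) i * Qtilde1 (N + 2) j + 2 * s) ?_
  -- Raising the cutoff from `j` to `N + 2` adds only terms whose second factor has negative index.
  refine Finset.sum_subset_zero_on_sdiff (Finset.Icc_subset_Icc_right hj) (fun k hk => ?_)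
    fun k hk => ?_
  · rw [Finset.mem_sdiff, Finset.mem_Icc, Finset.mem_Icc] at hk
    have h : ∀ c : ℤ, c ≤ j - k → restEsymm N c = 0 := fun c hc => esymmInt_neg _ c (by omega)
    rw [h (j - k) le_rfl, h (j - k - 1) (by omega), h (j - k - 1 - 1) (by omega)]
    ring
  · rw [Finset.mem_Icc] at hk
    rw [Qtilde1_eq_restEsymm, Qtilde1_eq_restEsymm]
    push_cast [Nat.cast_sub hk.2]
    rfl

/-- The skew-symmetric array of the `evenPart`s, with three rows added that hold the polynomials
`restEsymm`, shifted by `0`, `1` and `2`. -/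
noncomputable def borderedArray : Fin 3 ⊕ ℕ → Fin 3 ⊕ ℕ → MvPolynomial (Fin (N + 2)) ℤ
  | .inl _, .inl _ => 0
  | .inl s, .inr i => restEsymm N (i - (s : ℕ))
  | .inr i, .inl s => -restEsymm N (i - (s : ℕ))
  | .inr i, .inr j => if j < i then evenPart N i j else if i < j then -evenPart N j i else 0

theorem borderedArray_skew (a b : Fin 3 ⊕ ℕ) : borderedArray N a b = -borderedArray N b a := by
  rcases a with s | i <;> rcases b with t | j <;> simp only [borderedArray, neg_neg, neg_zero]
  rcases lt_trichotomy i j with h | rfl | h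
  · rw [if_neg h.not_gt, if_pos h, if_pos h]
  · simp
  · rw [if_pos h, if_neg h.not_gt, if_pos h, neg_neg]

/-- The first two variables enter the array only through the symmetric functions of their squares.
-/
theorem map_borderedArray (φ : MvPolynomial (Fin (N + 2)) ℤ →+* MvPolynomial (Fin (N + 2)) ℤ)
    (hφ : ∀ i : Fin N, φ (X i.succ.succ) = X i.succ.succ)
    (hadd : φ (X 0) ^ 2 + φ (X 1) ^ 2 = X 0 ^ 2 + X 1 ^ 2)
    (hmul : φ (X 0) ^ 2 * φ (X 1) ^ 2 = X 0 ^ 2 * X 1 ^ 2) (a b : Fin 3 ⊕ ℕ) :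
    φ (borderedArray N a b) = borderedArray N a b := by
  have h := map_restEsymm N φ hφ
  have hQ : ∀ i j, φ (quadQ (restEsymm N) (N + 2) i j) = quadQ (restEsymm N) (N + 2) i j := by
    intro i j
    simp [quadQ, h, map_ofNat φ 2]
  have hE : ∀ i j, φ (evenPart N i j) = evenPart N i j := by
    intro i j
    simp only [evenPart, map_add, map_mul, map_pow, hQ, hadd, hmul]
  rcases a with s | i <;> rcases b with t | j <;>
    simp only [borderedArray, map_neg, map_zero, h]
  split_ifs <;> simp [hE]

theorem part_ofFn {k : ℕ} (v : Fin k → ℕ) (i : Fin k) :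
    part (List.ofFn v) ((i : ℕ) + 1) = v i := by
  simp [part]

theorem Qtilde_ofFn (m : ℕ) (v : Fin (2 * m) → ℕ) (hv : StrictAnti v)
    (hle : ∀ i, v i ≤ N + 2) (A : Fin 3 ⊕ ℕ → Fin 3 ⊕ ℕ → MvPolynomial (Fin (N + 2)) ℤ)
    (hA : ∀ i j, j < i → j ≤ N + 2 → A (.inr i) (.inr j) = Qtilde2 (N + 2) i j) :
    Qtilde (N + 2) (List.ofFn v) = tuplePfaffian A (2 * m) (fun i => .inr (v i)) := by
  -- The size `(length + 1) / 2` occurs in the type of the array, so it is generalized before being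
  -- identified with `m`.
  have key : ∀ m', m' = m → pfaffian m' (fun i j : Fin (2 * m') => Qtilde2 (N + 2)
      (part (List.ofFn v) ((i : ℕ) + 1)) (part (List.ofFn v) ((j : ℕ) + 1))) =
      tuplePfaffian A (2 * m) (fun i => .inr (v i)) := by
    rintro m' rfl
    refine pfaffian_eq_tuplePfaffian A _ _ _ fun i j hij => ?_
    rw [hA _ _ (hv hij) (hle j)]
    rw [part_ofFn, part_ofFn]
  exact key _ (by rw [List.length_ofFn]; omega)

end Decomposition

/-! ### The operator `∂₀ ∂₁' ∂₀` -/

section Operators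

variable {N : ℕ}

theorem divDiffSign_eq {σ : Type*} [DecidableEq σ] {i : σ} {f g : MvPolynomial σ ℤ}
    (h : f - signChange i f = 2 * X i * g) : divDiffSign i f = g := by
  rw [divDiffSign_spec] at h
  exact mul_left_cancel₀ (mul_ne_zero two_ne_zero (X_ne_zero i)) h

theorem divDiffSwap_eq {σ : Type*} [DecidableEq σ] {i j : σ} (hij : i ≠ j)
    {f g : MvPolynomial σ ℤ} (h : f - swapVars i j f = (X j - X i) * g) :
    divDiffSwap i j f = g := by
  rw [divDiffSwap_spec] at h
  refine mul_left_cancel₀ (sub_ne_zero.mpr fun e => hij (X_injective e).symm) h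

/-- `∂₀ ∂₁' ∂₀` is linear over polynomials that are invariant under `s₀` and `s₁`, and it
annihilates `1`, `x_1 + x_2` and `x_1 x_2`, and maps `x_1 x_2 (x_1 + x_2)` to `1`. -/
theorem del0_del1'_del0_eq (hn : 2 ≤ N + 2) (c₀ c₁ c₂ c₃ : MvPolynomial (Fin (N + 2)) ℤ)
    (h : ∀ c ∈ [c₀, c₁, c₂, c₃], signChange 0 c = c ∧ swapVars 0 1 c = c) :
    del0 hn (del1' hn (del0 hn (c₀ + (X 0 + X 1) * c₁ + X 0 * X 1 * (X 0 + X 1) * c₂ +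
      X 0 * X 1 * c₃))) = c₂ := by
  simp only [List.mem_cons, List.not_mem_nil, or_false, forall_eq_or_imp, forall_eq] at h
  obtain ⟨⟨a₀, b₀⟩, ⟨a₁, b₁⟩, ⟨a₂, b₂⟩, ⟨a₃, b₃⟩⟩ := h
  have s0 : signChange (0 : Fin (N + 2)) (X 0) = -X 0 := by simp [signChange]
  have s1 : signChange (0 : Fin (N + 2)) (X 1) = X 1 := by simp [signChange]
  have t0 : swapVars (0 : Fin (N + 2)) 1 (X 0) = X 1 := by simp [swapVars]
  have t1 : swapVars (0 : Fin (N + 2)) 1 (X 1) = X 0 := by simp [swapVars]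
  have e1 : del0 hn (c₀ + (X 0 + X 1) * c₁ + X 0 * X 1 * (X 0 + X 1) * c₂ + X 0 * X 1 * c₃) =
      c₁ + X 1 ^ 2 * c₂ + X 1 * c₃ := by
    refine divDiffSign_eq (i := (0 : Fin (N + 2))) ?_
    simp only [map_add, map_mul, s0, s1, a₀, a₁, a₂, a₃]
    ring
  have e2 : del1' hn (c₁ + X 1 ^ 2 * c₂ + X 1 * c₃) = (X 0 + X 1) * c₂ + c₃ := by
    refine divDiffSwap_eq (i := (0 : Fin (N + 2))) (j := 1) (by simp) ?_
    simp only [map_add, map_mul, map_pow, t1, b₁, b₂, b₃]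
    ring
  rw [e1, e2]
  refine divDiffSign_eq (i := (0 : Fin (N + 2))) ?_
  simp only [map_add, map_mul, s0, s1, a₂, a₃]
  ring

/-- `ℭ''_λ` is, up to sign, the Pfaffian of the invariant array bordered by two rows. -/
theorem C''_ofFn (hn : 2 ≤ N + 2) (m : ℕ) (v : Fin (2 * m) → ℕ) (hv : StrictAnti v)
    (hle : ∀ i, v i ≤ N + 2) :
    C'' hn (List.ofFn v) = -tuplePfaffian (borderedArray N) (2 * m + 2)
      (Fin.cons (.inl 2) (Fin.cons (.inl 1) (fun i => .inr (v i)) : Fin (2 * m + 1) → _)) := by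
  have hinv : ∀ (k : ℕ) (w : Fin k → Fin 3 ⊕ ℕ),
      signChange 0 (tuplePfaffian (borderedArray N) k w) = tuplePfaffian (borderedArray N) k w ∧
      swapVars 0 1 (tuplePfaffian (borderedArray N) k w) =
        tuplePfaffian (borderedArray N) k w := by
    intro k w
    constructor
    · refine (map_tuplePfaffian (signChange (0 : Fin (N + 2))).toRingHom _ k w).trans ?_
      congr 1
      funext a b
      refine map_borderedArray N _ (fun i => ?_) ?_ ?_ a b <;> simp [signChange]
    · refine (map_tuplePfaffian (swapVars (0 : Fin (N + 2)) 1).toRingHom _ k w).trans ?_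
      congr 1
      funext a b
      refine map_borderedArray N _ (fun i => ?_) ?_ ?_ a b
      · have h1 : i.succ.succ ≠ (1 : Fin (N + 2)) := by simp [Fin.ext_iff]
        simp [swapVars, Equiv.swap_apply_of_ne_of_ne (Fin.succ_ne_zero i.succ) h1]
      · simp [swapVars, add_comm]
      · simp [swapVars, mul_comm]
  rw [C'', Qtilde_ofFn N m v hv hle _ fun i j hij hj => ?_,
    tuplePfaffian_add_twoForm (p := .inl 0) (q := .inl 1) (r := .inl 2) (borderedArray N)
      (borderedArray_skew N) rfl rfl rfl (X 0 + X 1) (X 0 * X 1 * (X 0 + X 1)) (X 0 * X 1)]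
  -- The Pfaffians of the invariant array and of its three borderings serve as the invariant
  -- coefficients of `del0_del1'_del0_eq`.
  · rw [sub_eq_add_neg, neg_add, neg_add, ← mul_neg, ← mul_neg, ← mul_neg, ← add_assoc,
      ← add_assoc]
    refine del0_del1'_del0_eq hn _ _ _ _ ?_
    simp [hinv]
  · rw [Qtilde2_eq N i j hj]
    simp [borderedArray, hij]

/-- In the bordered 4×4 Pfaffian the invariant entry is multiplied by the entry of the two added
rows, which is 0; only a minor of these rows remains. -/
theorem C''_pair (hn : 2 ≤ N + 2) {a b : ℕ} (hab : b < a) (ha : a ≤ N + 2) :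
    C'' hn [a, b] = restEsymm N (a - 2) * restEsymm N (b - 1) -
      restEsymm N (a - 1) * restEsymm N (b - 2) := by
  have hv : StrictAnti ![a, b] := by
    rw [Fin.strictAnti_iff_succ_lt]
    simpa using hab
  have h := C''_ofFn hn 1 ![a, b] hv (by simp [Fin.forall_fin_two]; omega)
  have hl : List.ofFn (n := 2 * 1) ![a, b] = [a, b] := by simp
  rw [hl] at h
  rw [h, tuplePfaffian_cons_cons (n := 1), Fin.sum_univ_two, tuplePfaffian_cons, tuplePfaffian_cons]
  simp [borderedArray, tuplePfaffian_zero, Fin.removeNth]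
  ring

end Operators

/-! ### The vanishing sum -/

/-- Both lists are strictly decreasing, hence determined by their members. -/
theorem remove_ofFn {k : ℕ} (v : Fin (k + 2) → ℕ) (hv : StrictAnti v) (j : Fin (k + 1)) :
    remove (List.ofFn v) [v j.castSucc, v (Fin.last _)] =
      List.ofFn (j.removeNth (Fin.init v)) := by
  have hp : ∀ {l : ℕ} (u : Fin l → ℕ), StrictAnti u → (List.ofFn u).Pairwise (· > ·) :=
    fun u hu => List.pairwise_ofFn.mpr fun i j hij => hu hij
  refine List.Pairwise.eq_of_mem_iff (r := (· > ·)) ((hp v hv).filter _) (hp _ ?_) fun a => ?_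
  · exact fun x y hxy => hv (Fin.castSucc_lt_castSucc_iff.mpr
      (Fin.succAbove_lt_succAbove_iff.mpr hxy))
  · simp only [remove, List.mem_filter, List.mem_ofFn, List.mem_cons, List.not_mem_nil, or_false,
      not_or, decide_eq_true_eq, Fin.removeNth, Fin.init]
    constructor
    · rintro ⟨⟨i, rfl⟩, h1, h2⟩
      have hi : i ≠ Fin.last _ := fun e => h2 (by rw [e])
      obtain ⟨i, rfl⟩ := Fin.exists_castSucc_eq.mpr hi
      obtain ⟨x, rfl⟩ := Fin.exists_succAbove_eq (x := i) (y := j) fun e => h1 (by rw [e])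
      exact ⟨x, rfl⟩
    · rintro ⟨x, rfl⟩
      refine ⟨⟨_, rfl⟩, fun e => ?_, fun e => ?_⟩
      · exact Fin.succAbove_ne j x (Fin.castSucc_injective _ (hv.injective e))
      · exact (Fin.castSucc_lt_last _).ne (hv.injective e)

end LagrangianPfaffian

theorem mainTheorem4 (n : ℕ) (hn : 2 ≤ n) (lam : List ℕ) (hlam : IsStrictPartition n lam)
    (heven : Even lam.length) (hlen : 4 ≤ lam.length) :
    ∑ j ∈ Finset.Icc 1 (lam.length - 1),
      (-1) ^ (j - 1) * C'' hn [part lam j, part lam lam.length] *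
        C'' hn (remove lam [part lam j, part lam lam.length]) = 0 := by
  obtain ⟨N, rfl⟩ : ∃ N, n = N + 2 := ⟨n - 2, by omega⟩
  obtain ⟨k, v, rfl⟩ : ∃ (k : ℕ) (v : Fin k → ℕ), lam = List.ofFn v :=
    ⟨_, lam.get, (List.ofFn_get lam).symm⟩
  rw [List.length_ofFn] at heven hlen ⊢
  obtain ⟨m, rfl⟩ : ∃ m, k = 2 * m + 2 := by
    obtain ⟨l, hl⟩ := heven
    exact ⟨l - 1, by omega⟩
  obtain ⟨hpair, hmem⟩ := hlam
  have hv : StrictAnti v := fun i j hij => List.pairwise_ofFn.mp hpair hij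
  have hle : ∀ i, v i ≤ N + 2 := fun i => (hmem _ (List.mem_ofFn.mpr ⟨i, rfl⟩)).2
  set w : Fin (2 * m + 1) → Fin 3 ⊕ ℕ := fun i => .inr (v i.castSucc)
  have hlast : part (List.ofFn v) (2 * m + 2) = v (Fin.last _) := part_ofFn v (Fin.last _)
  have hpart : ∀ j : Fin (2 * m + 1), part (List.ofFn v) ((j : ℕ) + 1) = v j.castSucc :=
    fun j => part_ofFn v j.castSucc
  -- The minor from `C''_pair` is expanded along the last part, which does not depend on `j`; its
  -- sign is absorbed by the minus sign in `C''_ofFn`.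
  have hterm : ∀ j : Fin (2 * m + 1),
      (-1) ^ (j : ℕ) * C'' hn [part (List.ofFn v) ((j : ℕ) + 1),
        part (List.ofFn v) (2 * m + 2)] * C'' hn (remove (List.ofFn v)
          [part (List.ofFn v) ((j : ℕ) + 1), part (List.ofFn v) (2 * m + 2)]) =
      restEsymm N (v (Fin.last _) - 2) * ((-1) ^ (j : ℕ) *
        borderedArray N (.inl 1) (w j) * tuplePfaffian (borderedArray N) (2 * m + 2)
          (Fin.cons (.inl 2) (Fin.cons (.inl 1) (j.removeNth w) :
            Fin (2 * m + 1) → _))) -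
      restEsymm N (v (Fin.last _) - 1) * ((-1) ^ (j : ℕ) *
        borderedArray N (.inl 2) (w j) * tuplePfaffian (borderedArray N) (2 * m + 2)
          (Fin.cons (.inl 2) (Fin.cons (.inl 1) (j.removeNth w) :
            Fin (2 * m + 1) → _))) := by
    intro j
    rw [hlast, hpart, remove_ofFn v hv j, C''_pair hn (hv (Fin.castSucc_lt_last j)) (hle _),
      C''_ofFn hn m (j.removeNth (Fin.init v)) (fun x y hxy => hv (Fin.castSucc_lt_castSucc_iff.mpr
        (Fin.succAbove_lt_succAbove_iff.mpr hxy))) fun i => hle _]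
    have h1 : borderedArray N (.inl 1) (w j) = restEsymm N (v j.castSucc - 1) := rfl
    have h2 : borderedArray N (.inl 2) (w j) = restEsymm N (v j.castSucc - 2) := rfl
    rw [h1, h2]
    change _ * _ * -tuplePfaffian (borderedArray N) (2 * m + 2)
      (Fin.cons (.inl 2) (Fin.cons (.inl 1) (j.removeNth w) :
            Fin (2 * m + 1) → _)) = _
    ring
  have hsum : Finset.Icc 1 (2 * m + 2 - 1) = (Finset.range (2 * m + 1)).image (· + 1) := by
    ext x
    simp only [Finset.mem_Icc, Finset.mem_image, Finset.mem_range]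
    exact ⟨fun h => ⟨x - 1, by omega, by omega⟩, by rintro ⟨y, hy, rfl⟩; omega⟩
  rw [hsum, Finset.sum_image (add_left_injective 1).injOn]
  simp only [add_tsub_cancel_right]
  rw [Finset.sum_range fun x => (-1) ^ x * C'' hn [part (List.ofFn v) (x + 1),
        part (List.ofFn v) (2 * m + 2)] * C'' hn (remove (List.ofFn v)
          [part (List.ofFn v) (x + 1), part (List.ofFn v) (2 * m + 2)]),
    Finset.sum_congr rfl fun j _ => hterm j, Finset.sum_sub_distrib, ← Finset.mul_sum,
    ← Finset.mul_sum]
  have hA := borderedArray_skew N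
  -- All entries between added rows are 0, so the row summed against may coincide with one of the
  -- two bordering rows.
  have e1 := sum_mul_tuplePfaffian_removeNth (borderedArray N) (x := .inl 1) (y := .inl 2)
    (z := .inl 1) rfl rfl w
  have e2 := sum_mul_tuplePfaffian_removeNth (borderedArray N) (x := .inl 2) (y := .inl 2)
    (z := .inl 1) rfl rfl w
  rw [tuplePfaffian_swap_tail _ hA, tuplePfaffian_self _ hA, neg_zero] at e1
  rw [tuplePfaffian_self _ hA] at e2
  rw [e1, e2, mul_zero, mul_zero, sub_zero]
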